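/- Let $\mathbb{F}_q$ be a finite field of characteristic $p$, $\omega=e^{2\pi i/p}$. On $\mathbb{C}^q$ with basis $\{|x\rangle : x\in\mathbb{F}_q\}$ put $X(a)|x\rangle=|x+a\rangle$, $Z(b)|x\rangle=\omega^{\mathrm{tr}_{q/p}(bx)}|x\rangle$; for $v=(a|b)\in\mathbb{F}_q^{2n}$ put $E(v)=X(a_1)Z(b_1)\otimes\cdots\otimes X(a_n)Z(b_n)$, and let $\mathcal{P}_n=\{\omega^cE(v)\}$ be the Pauli group. An $[[n,k,d]]_q$ quantum code is a $q^k$-dimensional subspace $Q\subseteq\mathbb{C}^{q^n}$ that detects all errors $E(v)$ acting nontrivially on fewer than $d$ subsystems, i.e. for each such $v$ there is $c\in\mathbb{C}$ with $\langle u,E(v)w\rangle=c\langle u,w\rangle$ for all $u,w\in Q$. It is a stabilizer code with stabilizer $S$ if $S$ is an abelian subgroup of $\mathcal{P}_n$ and $Q$ is a joint eigenspace of $S$. It is $\mathbb{F}_q$-linear if, for some such $S$, the image of $S$ in $\mathbb{F}_q^{2n}$ under $\omega^cE(v)\mapsto v$ is an $\mathbb{F}_q$-subspace; a stabilizer matrix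 is then a matrix over $\mathbb{F}_q$ whose rows form an $\mathbb{F}_q$-basis of this image. It is a CSS code if it has a stabilizer generated by elements of the forms $\omega^cE(a|0)$ and $\omega^cE(0|b)$. Let $J=[n]\cup[n]^*$ with the involution $i\leftrightarrow i^*$. A set $S\subseteq J$ is admissible if $S\cap S^*=\emptyset$. Order $J$ by $n>\cdots>1>1^*>\cdots>n^*$; for a permutation $w$ of $J$ commuting with $*$ let $i\le^w j$ iff $w^{-1}i\le w^{-1}j$, and for equal-sized subsets $A,B$ let $A\le^wB$ iff, when both are listed in $\le^w$-increasing order, $a_i\le^w b_i$ for all $i$. A symplectic matroid of rank $r$ on $J$ is a collection $\mathcal{B}$ of admissible $r$-subsets (bases) such that for every such $w$ there is a unique $B\in\mathcal{B}$ with $A\le^wB$ for all $A\in\mathcal{B}$. It is homogeneous if $|B\cap[n]|$ is the same for all $B\in\mathcal{B}$. It is represented by $M\in\mathbb{F}_q^{r\times 2n}$, with columns indexed by $J$, if the rows of $M$ are a basis of a subspace isotropic for the symplectic form $\langle(a|b),(c|d)\rangle=a\cdot d-c\cdot b$ and $\mathcal{B}$ consists of the admissible $r$-sets $B$ for which the $r\times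 r$ minor of $M$ on the columns $B$ is nonzero; it is representable over $\mathbb{F}_q$ if some such $M$ exists. **Theorem.** Let $Q$ be an $\mathbb{F}_q$-linear $[[n,k,d]]_q$ stabilizer code. Then there is a symplectic matroid $\mathcal{M}$ on $J$, representable over $\mathbb{F}_q$ and of rank $n-k$, that is induced by $Q$: every stabilizer $S$ of $Q$ has a stabilizer matrix with $n-k$ rows, and every stabilizer matrix of $S$ represents $\mathcal{M}$. If $Q$ is a CSS code, then $\mathcal{M}$ is homogeneous. -/

import Mathlib

namespace QuantumSymplectic

/-! ### Symplectic matroids -/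

/-- The ground set `J = [n] ∪ [n]*`: `Sum.inl i` is `i`, `Sum.inr i` is `i*`. -/
abbrev J (n : ℕ) : Type := Fin n ⊕ Fin n

/-- The involution `i ↦ i*`, `i* ↦ i`. -/
def invol {n : ℕ} (x : J n) : J n := x.swap

/-- `S` is admissible when `S ∩ S* = ∅`. -/
def IsAdmissible {n : ℕ} (S : Finset (J n)) : Prop :=
  Disjoint S (S.image invol)

/-- A permutation of `J` is admissible when it commutes with the involution. -/
def IsAdmissiblePerm {n : ℕ} (w : Equiv.Perm (J n)) : Prop :=
  ∀ x, w (invol x) = invol (w x)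

/-- Heights realizing the standard ordering `n > ⋯ > 2 > 1 > 1* > 2* > ⋯ > n*` of `J`. -/
def height {n : ℕ} : J n → ℤ
  | Sum.inl i => (i : ℤ) + 1
  | Sum.inr i => -((i : ℤ) + 1)

/-- `x ≤ʷ y` if and only if `w⁻¹ x ≤ w⁻¹ y` in the standard ordering. -/
def LEPerm {n : ℕ} (w : Equiv.Perm (J n)) (x y : J n) : Prop :=
  height (w⁻¹ x) ≤ height (w⁻¹ y)

/-- The strict version of `≤ʷ`. -/
def LTPerm {n : ℕ} (w : Equiv.Perm (J n)) (x y : J n) : Prop :=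
  height (w⁻¹ x) < height (w⁻¹ y)

/-- `A ≤ʷ B` for subsets of equal size: writing both increasingly with respect to `≤ʷ` as
`A = {a₁ < ⋯ < aₘ}`, `B = {b₁ < ⋯ < bₘ}`, one has `aᵢ ≤ʷ bᵢ` for all `i`. -/
def SetLE {n : ℕ} (w : Equiv.Perm (J n)) (A B : Finset (J n)) : Prop :=
  ∃ (m : ℕ) (a b : Fin m → J n),
    (∀ i j, i < j → LTPerm w (a i) (a j)) ∧ (∀ i j, i < j → LTPerm w (b i) (b j)) ∧
    Finset.univ.image a = A ∧ Finset.univ.image b = B ∧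
    ∀ i, LEPerm w (a i) (b i)

/-- A symplectic matroid on `J = [n] ∪ [n]*`, given by its bases. -/
structure SymplecticMatroid (n : ℕ) where
  rank : ℕ
  bases : Set (Finset (J n))
  admissible : ∀ B ∈ bases, IsAdmissible B
  card_eq : ∀ B ∈ bases, B.card = rank
  /-- The Maximality condition. -/
  maximality : ∀ w : Equiv.Perm (J n), IsAdmissiblePerm w →
    ∃! B, B ∈ bases ∧ ∀ A ∈ bases, SetLE w A B

/-- The number `|B ∩ [n]|` is the same for all bases `B`. -/
def SymplecticMatroid.IsHomogeneous {n : ℕ} (𝓜 : SymplecticMatroid n) : Prop :=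
  ∀ B ∈ 𝓜.bases, ∀ B' ∈ 𝓜.bases,
    (B.filter (fun x => x.isLeft)).card = (B'.filter (fun x => x.isLeft)).card

/-- The symplectic form `⟨(a|b), (c|d)⟩ = a·d - c·b` on `F²ⁿ`. -/
def sympForm {F : Type*} [Field F] {n : ℕ} (u v : J n → F) : F :=
  ∑ i, u (Sum.inl i) * v (Sum.inr i) - ∑ i, v (Sum.inl i) * u (Sum.inr i)

/-- `U` is an isotropic subspace of the symplectic space `F²ⁿ`. -/
def IsIsotropic {F : Type*} [Field F] {n : ℕ} (U : Submodule F (J n → F)) : Prop :=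
  ∀ u ∈ U, ∀ v ∈ U, sympForm u v = 0

/-- `M = [A|B]`, with columns indexed by `J` and rows a basis of an isotropic subspace of
`F²ⁿ`, represents `𝓜`: the bases of `𝓜` are the admissible sets `B` of size `r` (the number of
rows) such that the `r × r` minor of `M` on the columns indexed by `B` is nonzero. -/
def Represents {F : Type*} [Field F] {n r : ℕ} (M : Matrix (Fin r) (J n) F)
    (𝓜 : SymplecticMatroid n) : Prop :=
  LinearIndependent F M.row ∧ IsIsotropic (Submodule.span F (Set.range M.row)) ∧
  𝓜.rank = r ∧
  ∀ B : Finset (J n), B ∈ 𝓜.bases ↔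
    IsAdmissible B ∧ ∃ e : Fin r ≃ B, (M.submatrix id (fun j => (e j : J n))).det ≠ 0

/-- `𝓜` is representable over the field `F`. -/
def SymplecticMatroid.IsRepresentable {n : ℕ} (𝓜 : SymplecticMatroid n)
    (F : Type*) [Field F] : Prop :=
  ∃ (r : ℕ) (M : Matrix (Fin r) (J n) F), Represents M 𝓜

/-! ### Error operators and the Pauli group -/

section Pauli

variable (p : ℕ) [Fact p.Prime] {F : Type*} [Field F] [Fintype F] [DecidableEq F]
  [Algebra (ZMod p) F] {n : ℕ}

/-- `ω ^ c` for `c ∈ ℤ/p`, where `ω = exp (2πi / p)`. -/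
noncomputable def omegaPow (c : ZMod p) : ℂ := ZMod.stdAddChar c

/-- `X(a)|x⟩ = |x + a⟩` on `ℂ^q`, as a matrix in the basis `{|x⟩ : x ∈ F}`. -/
def opX (a : F) : Matrix F F ℂ := fun y x => if y = x + a then 1 else 0

/-- `Z(b)|x⟩ = ω^{tr(bx)}|x⟩` on `ℂ^q`. -/
noncomputable def opZ (b : F) : Matrix F F ℂ :=
  Matrix.diagonal fun x => omegaPow p (Algebra.trace (ZMod p) F (b * x))

/-- The tensor product `A₁ ⊗ ⋯ ⊗ Aₙ` of operators on `ℂ^q`, as an operator on `ℂ^{qⁿ}`; the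
basis vector `|x₁⟩ ⊗ ⋯ ⊗ |xₙ⟩` is indexed by `x : Fin n → F`. -/
def tensorOp (A : Fin n → Matrix F F ℂ) : Matrix (Fin n → F) (Fin n → F) ℂ :=
  fun y x => ∏ i, A i (y i) (x i)

/-- The error operator `X(a₁)Z(b₁) ⊗ ⋯ ⊗ X(aₙ)Z(bₙ)` of `v = (a|b) ∈ F²ⁿ`. -/
noncomputable def errorOp (v : J n → F) : Matrix (Fin n → F) (Fin n → F) ℂ :=
  tensorOp fun i => opX (v (Sum.inl i)) * opZ p (v (Sum.inr i))

theorem omegaPow_add (c d : ZMod p) : omegaPow p (c + d) = omegaPow p c * omegaPow p d :=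
  AddChar.map_add_eq_mul _ _ _

theorem omegaPow_zero : omegaPow p 0 = 1 := AddChar.map_zero_eq_one _

theorem omegaPow_sum {ι : Type*} (s : Finset ι) (f : ι → ZMod p) :
    omegaPow p (∑ i ∈ s, f i) = ∏ i ∈ s, omegaPow p (f i) :=
  by
  classical
  induction s using Finset.induction_on with
  | empty => simp [omegaPow_zero]
  | insert a s ha ih => rw [Finset.sum_insert ha, Finset.prod_insert ha, omegaPow_add, ih]

theorem opX_mul_opZ_apply (a b y x : F) : (opX a * opZ p b) y x =
    if y = x + a then omegaPow p (Algebra.trace (ZMod p) F (b * x)) else 0 := by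
  simp [opZ, opX, Matrix.mul_diagonal]

theorem errorOp_apply (v : J n → F) (y x : Fin n → F) : errorOp p v y x =
    if y = x + (fun i => v (Sum.inl i)) then
      omegaPow p (Algebra.trace (ZMod p) F (∑ i, v (Sum.inr i) * x i)) else 0 := by
  simp only [errorOp, tensorOp, opX_mul_opZ_apply]
  split_ifs with h
  · rw [map_sum, omegaPow_sum]
    refine Finset.prod_congr rfl fun i _ => ?_
    exact if_pos (congrFun h i)
  · obtain ⟨i, hi⟩ := Function.ne_iff.mp h
    exact Finset.prod_eq_zero (Finset.mem_univ i) (if_neg hi)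

theorem errorOp_zero : errorOp p (0 : J n → F) = 1 := by
  ext y x
  rw [errorOp_apply, Matrix.one_apply]
  have : (x + fun i => (0 : J n → F) (Sum.inl i)) = x := by ext i; simp
  rw [this]
  simp [omegaPow_zero]

theorem errorOp_mul (v w : J n → F) : errorOp p v * errorOp p w =
    omegaPow p (Algebra.trace (ZMod p) F (∑ i, v (Sum.inr i) * w (Sum.inl i))) •
      errorOp p (v + w) := by
  ext y x
  simp only [Matrix.mul_apply, Matrix.smul_apply, errorOp_apply, smul_eq_mul]
  rw [Finset.sum_eq_single (x + fun i => w (Sum.inl i))]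
  · have e : (x + (fun i => w (Sum.inl i))) + (fun i => v (Sum.inl i))
        = x + fun i => (v + w) (Sum.inl i) := by
      ext i; simp only [Pi.add_apply]; ring
    rw [e, if_pos rfl]
    split_ifs with h
    · rw [← omegaPow_add, ← omegaPow_add, ← map_add, ← map_add, ← Finset.sum_add_distrib,
        ← Finset.sum_add_distrib]
      congr 2
      refine Finset.sum_congr rfl fun i _ => ?_
      simp only [Pi.add_apply]; ring
    · simp
  · intro z _ hz
    rw [if_neg hz, mul_zero]
  · simp

variable (F n) in
/-- The generalized Pauli group `𝓟ₙ = {ω^c X(a₁)Z(b₁) ⊗ ⋯ ⊗ X(aₙ)Z(bₙ)}`. -/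
noncomputable def pauliGroup : Subgroup (Matrix (Fin n → F) (Fin n → F) ℂ)ˣ where
  carrier := {s | ∃ (c : ZMod p) (v : J n → F), s.val = omegaPow p c • errorOp p v}
  mul_mem' := by
    rintro s t ⟨c, v, hs⟩ ⟨d, w, ht⟩
    refine ⟨c + d + Algebra.trace (ZMod p) F (∑ i, v (Sum.inr i) * w (Sum.inl i)), v + w, ?_⟩
    rw [Units.val_mul, hs, ht, Matrix.smul_mul, Matrix.mul_smul, errorOp_mul, smul_smul,
      smul_smul, omegaPow_add, omegaPow_add, mul_assoc]
  one_mem' := ⟨0, 0, by rw [omegaPow_zero, errorOp_zero, one_smul, Units.val_one]⟩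
  inv_mem' := by
    rintro s ⟨c, v, hs⟩
    refine ⟨-c - Algebra.trace (ZMod p) F (∑ i, (-v) (Sum.inr i) * v (Sum.inl i)), -v, ?_⟩
    refine Units.inv_eq_of_mul_eq_one_left ?_
    rw [hs, Matrix.smul_mul, Matrix.mul_smul, errorOp_mul, smul_smul, smul_smul,
      neg_add_cancel, errorOp_zero, ← omegaPow_add, ← omegaPow_add]
    rw [show ∀ t : ZMod p, -c - t + c + t = 0 from fun t => by ring, omegaPow_zero, one_smul]

/-! ### Quantum codes

The state space `ℂ^{qⁿ}` is `(Fin n → F) → ℂ` with the standard Hermitian inner product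
`⟨u, v⟩ = star u ⬝ᵥ v`. -/

/-- The number of subsystems on which the error operator of `v` acts nontrivially. -/
def weight (v : J n → F) : ℕ :=
  (Finset.univ.filter fun i => v (Sum.inl i) ≠ 0 ∨ v (Sum.inr i) ≠ 0).card

/-- The code `Q` detects the error `E`: compressing `E` to `Q` gives a scalar. -/
def Detects (Q : Submodule ℂ ((Fin n → F) → ℂ)) (E : Matrix (Fin n → F) (Fin n → F) ℂ) : Prop :=
  ∃ c : ℂ, ∀ u ∈ Q, ∀ v ∈ Q,
    dotProduct (star u) (E.mulVec v) = c * dotProduct (star u) v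

/-- `Q` is an `[[n,k,d]]_q` quantum code: a `q^k`-dimensional subspace of `ℂ^{qⁿ}` able to detect
all errors on fewer than `d` subsystems. -/
def IsQuantumCode (k d : ℕ) (Q : Submodule ℂ ((Fin n → F) → ℂ)) : Prop :=
  Module.finrank ℂ Q = Fintype.card F ^ k ∧
  ∀ v : J n → F, weight v < d → Detects Q (errorOp p v)

/-- `Q` is a stabilizer code with stabilizer `S`: `S` is an abelian subgroup of the Pauli group
and `Q` is a joint eigenspace of `S` (most often all the eigenvalues `ev s` are taken to be `1`). -/
def IsStabilizer (S : Subgroup (Matrix (Fin n → F) (Fin n → F) ℂ)ˣ)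
    (Q : Submodule ℂ ((Fin n → F) → ℂ)) : Prop :=
  S ≤ pauliGroup p F n ∧ (∀ s ∈ S, ∀ t ∈ S, s * t = t * s) ∧
  ∃ ev : (Matrix (Fin n → F) (Fin n → F) ℂ)ˣ → ℂ,
    ∀ v, v ∈ Q ↔ ∀ s ∈ S, s.val.mulVec v = ev s • v

/-- The image of `S` in `F²ⁿ` under `ω^c X(a₁)Z(b₁) ⊗ ⋯ ⊗ X(aₙ)Z(bₙ) ↦ (a|b)`. -/
def stabImage (S : Subgroup (Matrix (Fin n → F) (Fin n → F) ℂ)ˣ) : Set (J n → F) :=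
  {v | ∃ s ∈ S, ∃ c : ZMod p, s.val = omegaPow p c • errorOp p v}

/-- `Q` is an `F`-linear stabilizer code: it has a stabilizer whose image in `F²ⁿ` is an
`F`-linear subspace. -/
def IsLinearStabilizerCode (Q : Submodule ℂ ((Fin n → F) → ℂ)) : Prop :=
  ∃ S, IsStabilizer p S Q ∧ ∃ C : Submodule F (J n → F), (C : Set (J n → F)) = stabImage p S

/-- `M` is a stabilizer matrix for `S`: its rows form an `F`-basis of the image of `S`. -/
def IsStabilizerMatrix (S : Subgroup (Matrix (Fin n → F) (Fin n → F) ℂ)ˣ) {r : ℕ}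
    (M : Matrix (Fin r) (J n) F) : Prop :=
  LinearIndependent F M.row ∧
  (Submodule.span F (Set.range M.row) : Set (J n → F)) = stabImage p S

/-- `Q` is a CSS code: it has a stabilizer generated by operators each of which is, up to a
phase, purely of the form `X(a₁) ⊗ ⋯ ⊗ X(aₙ)` or purely of the form `Z(b₁) ⊗ ⋯ ⊗ Z(bₙ)`. -/
def IsCSSCode (Q : Submodule ℂ ((Fin n → F) → ℂ)) : Prop :=
  ∃ S, IsStabilizer p S Q ∧
    S = Subgroup.closure {s | s ∈ S ∧ ∃ (c : ZMod p) (v : J n → F),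
      s.val = omegaPow p c • errorOp p v ∧
      ((∀ i, v (Sum.inr i) = 0) ∨ (∀ i, v (Sum.inl i) = 0))}

end Pauli

end QuantumSymplectic

/-
The idea. Write `C` for the set of `v` such that `E(v)` acts on `Q` as a scalar. If `u` spans a
joint eigenline, then `v ↦ μ(v)⁻¹ E(v)`, with `μ(v)` the eigenvalue, is an honest representation of
any additive group of such `v`; its character vanishes away from `0`, so its space of invariants has
dimension `qⁿ` divided by the order of the group. Applying this both to `C` and to the image of a
stabilizer of `Q` shows that the two coincide: the image depends on `Q` only. It is isotropic, since
scalars commute and the trace form is nondegenerate.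

Every isotropic subspace `U` defines a symplectic matroid: for an ordering of the coordinates, the
positions of the leading entries of the vectors of `U` form a basis of `U`'s column matroid, which
dominates all the others by Gale's counting criterion. For an ordering reversed by `*` this basis
is admissible, because the symplectic form of a vector led by `i` and a vector led by `i*` is the
product of the two leading entries.
-/

namespace QuantumSymplectic

open scoped Matrix

/-! ### The orderings `≤ʷ` -/

section Order

variable {n : ℕ}

lemma height_injective : Function.Injective (height (n := n)) := by
  rintro (i | i) (j | j) h <;> simp only [height] at h
  · exact congrArg Sum.inl (Fin.ext (by omega))
  · omega
  · omega
  · exact congrArg Sum.inr (Fin.ext (by omega))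

lemma height_invol (x : J n) : height (invol x) = -height x := by
  rcases x with i | i <;> simp [height, invol]

/-- The height function of the ordering `≤ʷ`: `x ≤ʷ y` means `heightPerm w x ≤ heightPerm w y`. -/
def heightPerm (w : Equiv.Perm (J n)) (x : J n) : ℤ := height (w⁻¹ x)

lemma heightPerm_injective (w : Equiv.Perm (J n)) : Function.Injective (heightPerm w) :=
  height_injective.comp (w⁻¹).injective

lemma IsAdmissiblePerm.heightPerm_invol {w : Equiv.Perm (J n)} (hw : IsAdmissiblePerm w)
    (x : J n) : heightPerm w (invol x) = -heightPerm w x := by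
  have hcomm : w⁻¹ (invol x) = invol (w⁻¹ x) := by
    rw [Equiv.Perm.inv_eq_iff_eq, hw, ← Equiv.Perm.mul_apply, mul_inv_cancel, Equiv.Perm.one_apply]
  rw [heightPerm, hcomm, height_invol, heightPerm]

lemma exists_strictMono_comp_image_univ_eq {ι α : Type*} [DecidableEq ι] [LinearOrder α]
    {κ : ι → α} (hκ : Function.Injective κ) {A : Finset ι} {m : ℕ} (hA : A.card = m) :
    ∃ a : Fin m → ι, StrictMono (κ ∘ a) ∧ Finset.univ.image a = A := by
  let : LinearOrder ι := LinearOrder.lift' κ hκ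
  refine ⟨A.orderEmbOfFin hA, (A.orderEmbOfFin hA).strictMono, ?_⟩
  convert A.image_orderEmbOfFin_univ hA

lemma le_of_card_filter_lt_le {α : Type*} [LinearOrder α] {m : ℕ} {f g : Fin m → α}
    (hf : StrictMono f) (hg : StrictMono g)
    (h : ∀ t, (Finset.univ.filter fun i => g i < t).card ≤
      (Finset.univ.filter fun i => f i < t).card) : f ≤ g := by
  intro i
  by_contra! hlt
  have hIio : (Finset.univ.filter fun j => f j < f i) = Finset.Iio i := by
    ext j; simp [hf.lt_iff_lt]
  have hIic : Finset.Iic i ⊆ Finset.univ.filter fun j => g j < f i := fun j hj =>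
    Finset.mem_filter.mpr
      ⟨Finset.mem_univ j, (hg.monotone (Finset.mem_Iic.mp hj)).trans_lt hlt⟩
  have hcard := (Finset.card_le_card hIic).trans (h (f i))
  rw [hIio, Fin.card_Iic, Fin.card_Iio] at hcard
  omega

lemma setLE_iff {w : Equiv.Perm (J n)} {A B : Finset (J n)} :
    SetLE w A B ↔ ∃ (m : ℕ) (a b : Fin m → J n),
      StrictMono (heightPerm w ∘ a) ∧ StrictMono (heightPerm w ∘ b) ∧
      Finset.univ.image a = A ∧ Finset.univ.image b = B ∧ heightPerm w ∘ a ≤ heightPerm w ∘ b :=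
  Iff.rfl

/-- The counting criterion of Gale for comparing two sets elementwise. -/
lemma setLE_of_card_filter_heightPerm_lt_le (w : Equiv.Perm (J n)) {A B : Finset (J n)}
    (hcard : A.card = B.card)
    (h : ∀ t, (B.filter fun x => heightPerm w x < t).card ≤
      (A.filter fun x => heightPerm w x < t).card) : SetLE w A B := by
  obtain ⟨m, hm⟩ : ∃ m, B.card = m := ⟨_, rfl⟩
  obtain ⟨a, ha, rfl⟩ :=
    exists_strictMono_comp_image_univ_eq (heightPerm_injective w) (hcard.trans hm)
  obtain ⟨b, hb, rfl⟩ := exists_strictMono_comp_image_univ_eq (heightPerm_injective w) hm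
  refine setLE_iff.mpr ⟨m, a, b, ha, hb, rfl, rfl, le_of_card_filter_lt_le ha hb fun t => ?_⟩
  simpa only [Finset.filter_image, Finset.card_image_of_injective _ ha.injective.of_comp,
    Finset.card_image_of_injective _ hb.injective.of_comp, Function.comp_apply] using h t

namespace SetLE

variable {w : Equiv.Perm (J n)} {A B : Finset (J n)}

lemma sum_heightPerm_le (h : SetLE w A B) :
    ∑ x ∈ A, heightPerm w x ≤ ∑ x ∈ B, heightPerm w x := by
  obtain ⟨m, a, b, ha, hb, rfl, rfl, hab⟩ := setLE_iff.mp h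
  rw [Finset.sum_image ha.injective.of_comp.injOn, Finset.sum_image hb.injective.of_comp.injOn]
  exact Finset.sum_le_sum fun i _ => hab i

lemma eq_of_sum_heightPerm_eq (h : SetLE w A B)
    (hsum : ∑ x ∈ A, heightPerm w x = ∑ x ∈ B, heightPerm w x) : A = B := by
  obtain ⟨m, a, b, ha, hb, rfl, rfl, hab⟩ := setLE_iff.mp h
  rw [Finset.sum_image ha.injective.of_comp.injOn,
    Finset.sum_image hb.injective.of_comp.injOn] at hsum
  have hab_eq := (Finset.sum_eq_sum_iff_of_le fun i _ => hab i).mp hsum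
  rw [funext fun i => heightPerm_injective w (hab_eq i (Finset.mem_univ i))]

lemma antisymm (h : SetLE w A B) (h' : SetLE w B A) : A = B :=
  h.eq_of_sum_heightPerm_eq (h.sum_heightPerm_le.antisymm h'.sum_heightPerm_le)

end SetLE

end Order

/-! ### Information sets and leading positions -/

section InfoSet

variable {F ι : Type*} [Field F]

/-- The coordinates in `B` separate the vectors of the subspace `U`; for linear `U` it suffices
to separate from `0`. -/
def IsSeparatingSet (U : Submodule F (ι → F)) (B : Finset ι) : Prop :=
  ∀ u ∈ U, (∀ j ∈ B, u j = 0) → u = 0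

/-- `B` is an information set of `U`, i.e. a basis of the column matroid of `U`: restriction to the
coordinates in `B` identifies `U` with `F^B`. -/
def IsInfoSet (U : Submodule F (ι → F)) (B : Finset ι) : Prop :=
  B.card = Module.finrank F U ∧ IsSeparatingSet U B

lemma IsSeparatingSet.finrank_le_card {U : Submodule F (ι → F)} {B : Finset ι}
    (h : IsSeparatingSet U B) : Module.finrank F U ≤ B.card := by
  let restrict : U →ₗ[F] (B → F) := (LinearMap.funLeft F F ((↑) : B → ι)).comp U.subtype
  have hinj : Function.Injective restrict := by
    refine (injective_iff_map_eq_zero restrict).mpr fun u hu => ?_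
    exact Subtype.ext (h u u.2 fun j hj => congrFun hu ⟨j, hj⟩)
  simpa using LinearMap.finrank_le_finrank_of_injective hinj

variable {α : Type*} [LinearOrder α] {κ : ι → α} {U : Submodule F (ι → F)}

/-- The position `j` is a leading position of `U` with respect to the ordering of the coordinates
by `κ`: some vector of `U` is nonzero at `j` and vanishes at all larger positions. -/
def IsLeading (κ : ι → α) (U : Submodule F (ι → F)) (j : ι) : Prop :=
  ∃ u ∈ U, u j ≠ 0 ∧ ∀ i, κ j < κ i → u i = 0

lemma linearIndependent_of_leading (hκ : Function.Injective κ) {s : Finset ι} {v : s → ι → F}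
    (hne : ∀ j, v j j ≠ 0) (hzero : ∀ (j : s) (i), κ j < κ i → v j i = 0) :
    LinearIndependent F v := by
  classical
  rw [Fintype.linearIndependent_iff]
  intro g hg
  by_contra! hg_ne
  obtain ⟨j, hj, hmax⟩ := (Finset.univ.filter fun j => g j ≠ 0).exists_max_image
    (fun j => κ j) (by simpa [Finset.filter_nonempty_iff] using hg_ne)
  have hterm (i : s) (hij : i ≠ j) : g i * v i j = 0 := by
    by_cases hgi : g i = 0
    · rw [hgi, zero_mul]
    · have hle : κ i ≤ κ j := hmax i (by simpa using hgi)
      rw [hzero i j (hle.lt_of_ne fun h => hij (Subtype.ext (hκ h))), mul_zero]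
  have hsum : g j * v j j = 0 := by
    simpa [Finset.sum_eq_single j (fun i _ => hterm i)] using congrFun hg (j : ι)
  exact mul_ne_zero (Finset.mem_filter.mp hj).2 (hne j) hsum

/-- The vectors of `U` supported on the positions below `t`. -/
def truncate (κ : ι → α) (U : Submodule F (ι → F)) (t : α) : Submodule F (ι → F) :=
  U ⊓ Submodule.pi {i | t ≤ κ i} fun _ => ⊥

lemma mem_truncate {t : α} {u : ι → F} :
    u ∈ truncate κ U t ↔ u ∈ U ∧ ∀ i, t ≤ κ i → u i = 0 := by
  simp [truncate, Submodule.mem_pi]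

lemma IsSeparatingSet.truncate {A : Finset ι} (hA : IsSeparatingSet U A) (t : α) :
    IsSeparatingSet (truncate κ U t) (A.filter fun j => κ j < t) := by
  intro u hu h
  obtain ⟨huU, hut⟩ := mem_truncate.mp hu
  refine hA u huU fun j hj => ?_
  rcases lt_or_ge (κ j) t with hjt | hjt
  · exact h j (Finset.mem_filter.mpr ⟨hj, hjt⟩)
  · exact hut j hjt

variable [Fintype ι]

open Classical in
/-- The set of leading positions of `U`, which turns out to be the largest information set of `U`
with respect to the ordering by `κ`. -/
noncomputable def leadingSet (κ : ι → α) (U : Submodule F (ι → F)) : Finset ι :=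
  Finset.univ.filter (IsLeading κ U)

lemma mem_leadingSet {j : ι} : j ∈ leadingSet κ U ↔ IsLeading κ U j := by
  simp [leadingSet]

lemma isSeparatingSet_leadingSet (κ : ι → α) (U : Submodule F (ι → F)) :
    IsSeparatingSet U (leadingSet κ U) := by
  classical
  intro u hu h
  by_contra hne
  obtain ⟨j, hj, hmax⟩ := (Finset.univ.filter fun j => u j ≠ 0).exists_max_image κ
    (by simpa [Finset.filter_nonempty_iff] using Function.ne_iff.mp hne)
  refine (Finset.mem_filter.mp hj).2 (h j (mem_leadingSet.mpr
    ⟨u, hu, (Finset.mem_filter.mp hj).2, fun i hi => ?_⟩))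
  by_contra hui
  exact (hmax i (by simpa using hui)).not_gt hi

lemma card_leadingSet (hκ : Function.Injective κ) (U : Submodule F (ι → F)) :
    (leadingSet κ U).card = Module.finrank F U := by
  refine le_antisymm ?_ (isSeparatingSet_leadingSet κ U).finrank_le_card
  choose u huU hne hzero using fun j : leadingSet κ U => mem_leadingSet.mp j.2
  have hli : LinearIndependent F fun j => (⟨u j, huU j⟩ : U) :=
    .of_comp U.subtype (linearIndependent_of_leading hκ hne hzero)
  simpa only [Fintype.card_coe] using hli.fintype_card_le_finrank

lemma isInfoSet_leadingSet (hκ : Function.Injective κ) (U : Submodule F (ι → F)) :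
    IsInfoSet U (leadingSet κ U) :=
  ⟨card_leadingSet hκ U, isSeparatingSet_leadingSet κ U⟩

lemma leadingSet_truncate (κ : ι → α) (U : Submodule F (ι → F)) (t : α) :
    leadingSet κ (truncate κ U t) = (leadingSet κ U).filter fun j => κ j < t := by
  ext j
  simp only [Finset.mem_filter, mem_leadingSet, IsLeading, mem_truncate]
  constructor
  · rintro ⟨u, ⟨hu, ht⟩, hj, hzero⟩
    exact ⟨⟨u, hu, hj, hzero⟩, not_le.mp fun h => hj (ht j h)⟩
  · rintro ⟨⟨u, hu, hj, hzero⟩, hjt⟩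
    exact ⟨u, ⟨hu, fun i hi => hzero i (hjt.trans_le hi)⟩, hj, hzero⟩

lemma card_filter_leadingSet_le (hκ : Function.Injective κ) {A : Finset ι}
    (hA : IsSeparatingSet U A) (t : α) :
    ((leadingSet κ U).filter fun j => κ j < t).card ≤ (A.filter fun j => κ j < t).card := by
  rw [← leadingSet_truncate, card_leadingSet hκ]
  exact (hA.truncate t).finrank_le_card

lemma IsInfoSet.setLE_leadingSet {n : ℕ} {U : Submodule F (J n → F)} {A : Finset (J n)}
    (hA : IsInfoSet U A) (w : Equiv.Perm (J n)) : SetLE w A (leadingSet (heightPerm w) U) :=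
  setLE_of_card_filter_heightPerm_lt_le w
    (hA.1.trans (card_leadingSet (heightPerm_injective w) U).symm)
    (card_filter_leadingSet_le (heightPerm_injective w) hA.2)

end InfoSet

/-! ### The symplectic matroid of an isotropic subspace -/

section Isotropic

variable {F : Type*} [Field F] {n : ℕ}

lemma sympForm_eq_mul_of_leading {α : Type*} [LinearOrder α] {κ : J n → α}
    (hκ : Function.Injective κ) (hinv : ∀ x y, κ x < κ y → κ (invol y) < κ (invol x))
    {i : Fin n} {u v : J n → F} (hu : ∀ x, κ (Sum.inl i) < κ x → u x = 0)
    (hv : ∀ x, κ (Sum.inr i) < κ x → v x = 0) :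
    sympForm u v = u (Sum.inl i) * v (Sum.inr i) := by
  have hterm (x : J n) (hx : x ≠ Sum.inl i) : u x * v (invol x) = 0 := by
    rcases lt_trichotomy (κ (Sum.inl i)) (κ x) with h | h | h
    · rw [hu x h, zero_mul]
    · exact absurd (hκ h).symm hx
    · rw [hv (invol x) (hinv _ _ h), mul_zero]
  have hleft : ∑ j, u (Sum.inl j) * v (Sum.inr j) = u (Sum.inl i) * v (Sum.inr i) :=
    Fintype.sum_eq_single i fun j hj => hterm (Sum.inl j) (Sum.inl_injective.ne hj)
  have hright : ∑ j, v (Sum.inl j) * u (Sum.inr j) = 0 :=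
    Fintype.sum_eq_zero _ fun j => (mul_comm _ _).trans (hterm (Sum.inr j) Sum.inr_ne_inl)
  rw [sympForm, hleft, hright, sub_zero]

lemma IsIsotropic.isAdmissible_leadingSet {α : Type*} [LinearOrder α] {κ : J n → α}
    {U : Submodule F (J n → F)} (hU : IsIsotropic U) (hκ : Function.Injective κ)
    (hinv : ∀ x y, κ x < κ y → κ (invol y) < κ (invol x)) : IsAdmissible (leadingSet κ U) := by
  have hnot_both (i : Fin n) (hl : IsLeading κ U (Sum.inl i))
      (hr : IsLeading κ U (Sum.inr i)) : False := by
    obtain ⟨u, huU, hui, hu⟩ := hl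
    obtain ⟨v, hvU, hvi, hv⟩ := hr
    refine mul_ne_zero hui hvi ?_
    rw [← sympForm_eq_mul_of_leading hκ hinv hu hv, hU u huU v hvU]
  rw [IsAdmissible, Finset.disjoint_left]
  intro x hx hx'
  obtain ⟨y, hy, rfl⟩ := Finset.mem_image.mp hx'
  rw [mem_leadingSet] at hx hy
  rcases y with i | i
  · exact hnot_both i hy hx
  · exact hnot_both i hx hy

/-- The symplectic matroid of an isotropic subspace: its bases are the admissible information
sets. -/
noncomputable def SymplecticMatroid.ofIsotropic (U : Submodule F (J n → F))
    (hU : IsIsotropic U) : SymplecticMatroid n where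
  rank := Module.finrank F U
  bases := {B | IsAdmissible B ∧ IsInfoSet U B}
  admissible _ hB := hB.1
  card_eq _ hB := hB.2.1
  maximality w hw := by
    have hκ := heightPerm_injective w
    have hinv (x y) (h : heightPerm w x < heightPerm w y) :
        heightPerm w (invol y) < heightPerm w (invol x) := by
      simpa only [hw.heightPerm_invol, neg_lt_neg_iff] using h
    have hlead : IsAdmissible (leadingSet (heightPerm w) U) ∧
        IsInfoSet U (leadingSet (heightPerm w) U) :=
      ⟨hU.isAdmissible_leadingSet hκ hinv, isInfoSet_leadingSet hκ U⟩
    exact ⟨_, ⟨hlead, fun A hA => hA.2.setLE_leadingSet w⟩,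
      fun B hB => (hB.1.2.setLE_leadingSet w).antisymm (hB.2 _ hlead)⟩

lemma det_submatrix_ne_zero_iff {m ι : Type*} [Fintype m] [DecidableEq m] {M : Matrix m ι F}
    (hM : LinearIndependent F M.row) (e : m → ι) :
    (M.submatrix id e).det ≠ 0 ↔
      ∀ u ∈ Submodule.span F (Set.range M.row), (∀ i, u (e i) = 0) → u = 0 := by
  have hsub (x : m → F) : x ᵥ* M.submatrix id e = (x ᵥ* M) ∘ e := rfl
  have hinj (x : m → F) : x ᵥ* M = 0 ↔ x = 0 :=
    map_eq_zero_iff M.vecMulLinear (Matrix.vecMul_injective_iff.mpr hM)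
  rw [ne_eq, ← Matrix.exists_vecMul_eq_zero_iff, ← range_vecMulLinear]
  simp only [LinearMap.mem_range, forall_exists_index, forall_apply_eq_imp_iff,
    Matrix.vecMulLinear_apply, hinj, hsub, funext_iff (f := _ ∘ e), not_exists, not_and']
  simp only [Function.comp_apply, Pi.zero_apply, not_ne_iff]

lemma represents_ofIsotropic {r : ℕ} {M : Matrix (Fin r) (J n) F}
    (hM : LinearIndependent F M.row) {U : Submodule F (J n → F)} (hU : IsIsotropic U)
    (hspan : Submodule.span F (Set.range M.row) = U) :
    Represents M (SymplecticMatroid.ofIsotropic U hU) := by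
  have hr : Module.finrank F U = r := by
    rw [← hspan, finrank_span_eq_card hM, Fintype.card_fin]
  have hdet {B : Finset (J n)} (e : Fin r ≃ B) :
      (M.submatrix id fun j => (e j : J n)).det ≠ 0 ↔ IsSeparatingSet U B := by
    rw [det_submatrix_ne_zero_iff hM, hspan]
    simp only [IsSeparatingSet, e.forall_congr_left, Equiv.apply_symm_apply, Subtype.forall]
  refine ⟨hM, hspan ▸ hU, hr, fun B => and_congr_right fun _ => ⟨?_, ?_⟩⟩
  · rintro ⟨hcard, hsep⟩
    let e : Fin r ≃ B := (Fintype.equivFinOfCardEq (by simp [hcard, hr])).symm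
    exact ⟨e, (hdet e).mpr hsep⟩
  · rintro ⟨e, he⟩
    have hcard : r = B.card := by simpa using Fintype.card_congr e
    exact ⟨hcard.symm.trans hr.symm, (hdet e).mp he⟩

lemma exists_matrix_span_range_row_eq {ι : Type*} (U : Submodule F (ι → F)) [Module.Finite F U] :
    ∃ M : Matrix (Fin (Module.finrank F U)) ι F,
      LinearIndependent F M.row ∧ Submodule.span F (Set.range M.row) = U := by
  let b := Module.finBasis F U
  refine ⟨fun i => b i, b.linearIndependent.map' U.subtype U.ker_subtype, ?_⟩
  change Submodule.span F (Set.range (U.subtype ∘ b)) = U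
  rw [Set.range_comp, Submodule.span_image, b.span_eq, Submodule.map_top, Submodule.range_subtype]

end Isotropic

/-! ### Homogeneity -/

section Homogeneous

variable {F ι : Type*} [Field F]

/-- The coordinate projection of `F^ι` that keeps the coordinates in `s` and sets the others
to zero. -/
noncomputable def coordProj (s : Set ι) : (ι → F) →ₗ[F] (ι → F) where
  toFun := s.indicator
  map_add' := Set.indicator_add s
  map_smul' := Set.indicator_const_smul s

lemma coordProj_apply_of_notMem {s : Set ι} {i : ι} (hi : i ∉ s) (u : ι → F) :
    coordProj s u i = 0 :=
  Set.indicator_of_notMem hi u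

lemma coordProj_add_coordProj_compl (s : Set ι) (u : ι → F) :
    coordProj s u + coordProj sᶜ u = u :=
  Set.indicator_self_add_compl s u

lemma coordProj_eq_self {s : Set ι} {u : ι → F} (h : ∀ i ∉ s, u i = 0) : coordProj s u = u :=
  Set.indicator_eq_self.mpr (Function.support_subset_iff'.mpr h)

lemma coordProj_eq_zero {s : Set ι} {u : ι → F} (h : ∀ i ∈ s, u i = 0) : coordProj s u = 0 :=
  Set.indicator_eq_zero.mpr (Set.disjoint_left.mpr fun i hi his => hi (h i his))

variable {U : Submodule F (ι → F)} {s : Set ι} {B : Finset ι}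

lemma coordProj_compl_mem (hU : ∀ u ∈ U, coordProj s u ∈ U) {u : ι → F} (hu : u ∈ U) :
    coordProj sᶜ u ∈ U := by
  rw [eq_sub_of_add_eq' (coordProj_add_coordProj_compl s u)]
  exact U.sub_mem hu (hU u hu)

lemma IsSeparatingSet.map_coordProj [DecidablePred (· ∈ s)] (hB : IsSeparatingSet U B)
    (hU : ∀ u ∈ U, coordProj s u ∈ U) :
    IsSeparatingSet (U.map (coordProj s)) (B.filter (· ∈ s)) := by
  rintro _ ⟨u, hu, rfl⟩ hzero
  refine hB _ (hU u hu) fun j hj => ?_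
  by_cases hjs : j ∈ s
  · exact hzero j (Finset.mem_filter.mpr ⟨hj, hjs⟩)
  · exact coordProj_apply_of_notMem hjs u

lemma finrank_le_finrank_map_coordProj_add [Finite ι] (U : Submodule F (ι → F)) (s : Set ι) :
    Module.finrank F U ≤ Module.finrank F (U.map (coordProj s)) +
      Module.finrank F (U.map (coordProj sᶜ)) := by
  refine (Submodule.finrank_mono fun u hu => ?_).trans
    (Submodule.finrank_add_le_finrank_add_finrank _ _)
  rw [← coordProj_add_coordProj_compl s u]
  exact Submodule.add_mem_sup (Submodule.mem_map_of_mem hu) (Submodule.mem_map_of_mem hu)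

lemma IsInfoSet.card_filter_mem_eq [Finite ι] [DecidablePred (· ∈ s)] (hB : IsInfoSet U B)
    (hU : ∀ u ∈ U, coordProj s u ∈ U) :
    (B.filter (· ∈ s)).card = Module.finrank F (U.map (coordProj s)) := by
  have hin := (hB.2.map_coordProj hU).finrank_le_card
  have hout := (hB.2.map_coordProj fun _ => coordProj_compl_mem hU).finrank_le_card
  have hadd := finrank_le_finrank_map_coordProj_add U s
  have hsplit := B.card_filter_add_card_filter_not (· ∈ s)
  simp only [Set.mem_compl_iff] at hout
  have hcard := hB.1
  omega

lemma isHomogeneous_ofIsotropic {n : ℕ} {U : Submodule F (J n → F)} (hU : IsIsotropic U)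
    (hleft : ∀ u ∈ U, coordProj {x | x.isLeft} u ∈ U) :
    (SymplecticMatroid.ofIsotropic U hU).IsHomogeneous := fun _ hB _ hB' =>
  (hB.2.card_filter_mem_eq hleft).trans (hB'.2.card_filter_mem_eq hleft).symm

end Homogeneous

/-! ### Error operators -/

section ErrorOp

lemma exists_trace_mul_ne_zero {K L : Type*} [Field K] [Field L] [Algebra K L]
    [FiniteDimensional K L] [Algebra.IsSeparable K L] {a : L} (ha : a ≠ 0) :
    ∃ b, Algebra.trace K L (b * a) ≠ 0 := by
  by_contra! h
  refine ha ((traceForm_nondegenerate K L).1 a fun b => ?_)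
  rw [Algebra.traceForm_apply, mul_comm, h]

lemma finrank_invariants_mul_card {k G V : Type*} [Field k] [CharZero k] [Group G] [Finite G]
    [AddCommGroup V] [Module k V] [FiniteDimensional k V] (ρ : Representation k G V)
    (h : ∀ g ≠ 1, LinearMap.trace k V (ρ g) = 0) :
    Module.finrank k ρ.invariants * Nat.card G = Module.finrank k V := by
  have := Fintype.ofFinite G
  have hcard : (Fintype.card G : k) ≠ 0 := Nat.cast_ne_zero.mpr Fintype.card_ne_zero
  have := invertibleOfNonzero hcard
  have htrace := ρ.isProj_averageMap.trace
  have hsum : ∑ g, LinearMap.trace k V (ρ g) = Module.finrank k V := by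
    rw [Fintype.sum_eq_single 1 h, map_one, LinearMap.trace_one]
  simp only [Representation.averageMap, GroupAlgebra.average, map_smul, map_sum,
    Representation.asAlgebraHom_of, hsum, smul_eq_mul] at htrace
  rw [invOf_mul_eq_iff_eq_mul_left] at htrace
  rw [Nat.card_eq_fintype_card, mul_comm]
  exact_mod_cast htrace.symm

variable (p : ℕ) [Fact p.Prime]

lemma omegaPow_injective : Function.Injective (omegaPow p) := ZMod.injective_stdAddChar

lemma omegaPow_ne_zero (c : ZMod p) : omegaPow p c ≠ 0 := fun h =>
  one_ne_zero <| by rw [← omegaPow_zero p, ← add_neg_cancel c, omegaPow_add, h, zero_mul]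

variable {F : Type*} [Field F] [Algebra (ZMod p) F] {n : ℕ}

/-- The phase in `E(v) E(w) = cocycle(v, w) E(v + w)`. -/
noncomputable def cocycle (v w : J n → F) : ℂ :=
  omegaPow p (Algebra.trace (ZMod p) F (∑ i, v (Sum.inr i) * w (Sum.inl i)))

lemma cocycle_ne_zero (v w : J n → F) : cocycle p v w ≠ 0 := omegaPow_ne_zero p _

lemma cocycle_comm_iff {v w : J n → F} :
    cocycle p v w = cocycle p w v ↔ Algebra.trace (ZMod p) F (sympForm v w) = 0 := by
  rw [cocycle, cocycle, (omegaPow_injective p).eq_iff, eq_comm, ← sub_eq_zero, ← map_sub, sympForm]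
  simp only [mul_comm]

variable [Fintype F]

lemma sum_omegaPow_trace_dotProduct_eq_zero {b : Fin n → F} (hb : b ≠ 0) :
    ∑ x : Fin n → F, omegaPow p (Algebra.trace (ZMod p) F (b ⬝ᵥ x)) = 0 := by
  classical
  obtain ⟨i, hi⟩ := Function.ne_iff.mp hb
  obtain ⟨c, hc⟩ := exists_trace_mul_ne_zero (K := ZMod p) hi
  let f : (Fin n → F) →+ ZMod p :=
    AddMonoidHom.mk' (fun x => Algebra.trace (ZMod p) F (b ⬝ᵥ x)) fun x y => by
      rw [dotProduct_add, map_add]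
  refine AddChar.sum_eq_zero_of_ne_one (ψ := ZMod.stdAddChar.compAddMonoidHom f) ?_
  refine AddChar.ne_one_iff.mpr ⟨Pi.single i c, fun h => hc (omegaPow_injective p ?_)⟩
  rw [omegaPow_zero, mul_comm, ← dotProduct_single]
  exact h

variable [DecidableEq F]

lemma trace_errorOp {v : J n → F} (hv : v ≠ 0) : (errorOp p v).trace = 0 := by
  simp only [Matrix.trace, Matrix.diag_apply, errorOp_apply, left_eq_add]
  split_ifs with ha
  · refine sum_omegaPow_trace_dotProduct_eq_zero p fun hb => hv ?_
    exact funext fun j => j.rec (congrFun ha) (congrFun hb)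
  · exact Finset.sum_const_zero

lemma trace_errorOp_zero : (errorOp p (0 : J n → F)).trace = (Fintype.card F : ℂ) ^ n := by
  rw [errorOp_zero, Matrix.trace_one, Fintype.card_pi_const, Nat.cast_pow]

variable {p} in
lemma eq_of_smul_errorOp_eq {a b : ℂ} (ha : a ≠ 0) {v w : J n → F}
    (h : a • errorOp p v = b • errorOp p w) : v = w := by
  by_contra hne
  have hsub : -v + w ≠ 0 := mt neg_add_eq_zero.mp hne
  have htrace := congrArg (fun A => (errorOp p (-v) * A).trace) h
  simp only [Matrix.mul_smul, errorOp_mul, Matrix.trace_smul, neg_add_cancel, trace_errorOp_zero,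
    trace_errorOp p hsub, smul_zero] at htrace
  refine smul_ne_zero ha (smul_ne_zero (omegaPow_ne_zero p _) ?_) htrace
  exact pow_ne_zero n (Nat.cast_ne_zero.mpr Fintype.card_ne_zero)

lemma errorOp_mulVec_mulVec (v w : J n → F) (u : (Fin n → F) → ℂ) :
    errorOp p v *ᵥ errorOp p w *ᵥ u = cocycle p v w • errorOp p (v + w) *ᵥ u := by
  rw [Matrix.mulVec_mulVec, errorOp_mul, Matrix.smul_mulVec, cocycle]

lemma errorOp_neg_mulVec_mulVec (v : J n → F) (u : (Fin n → F) → ℂ) :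
    errorOp p (-v) *ᵥ errorOp p v *ᵥ u = cocycle p (-v) v • u := by
  rw [errorOp_mulVec_mulVec, neg_add_cancel, errorOp_zero, Matrix.one_mulVec]

variable {p}

lemma eigenvalue_ne_zero {v : J n → F} {u : (Fin n → F) → ℂ} (hu : u ≠ 0) {c : ℂ}
    (h : errorOp p v *ᵥ u = c • u) : c ≠ 0 := by
  rintro rfl
  refine smul_ne_zero (cocycle_ne_zero p (-v) v) hu ?_
  rw [← errorOp_neg_mulVec_mulVec, h, zero_smul, Matrix.mulVec_zero]

lemma eigenvalue_zero {u : (Fin n → F) → ℂ} (hu : u ≠ 0) {c : ℂ}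
    (h : errorOp p (0 : J n → F) *ᵥ u = c • u) : c = 1 := by
  rw [errorOp_zero, Matrix.one_mulVec] at h
  exact smul_left_injective ℂ hu (by simpa only [one_smul] using h.symm)

lemma eigenvalue_mul {v w : J n → F} {u : (Fin n → F) → ℂ} (hu : u ≠ 0) {a b c : ℂ}
    (hv : errorOp p v *ᵥ u = a • u) (hw : errorOp p w *ᵥ u = b • u)
    (hvw : errorOp p (v + w) *ᵥ u = c • u) : a * b = cocycle p v w * c := by
  refine smul_left_injective ℂ hu ?_
  simp only [mul_smul]
  rw [← hvw, ← errorOp_mulVec_mulVec, hw, Matrix.mulVec_smul, hv, smul_comm]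

/-- The representation `v ↦ μ(v)⁻¹ E(v)` of a group `C` of error operators with joint eigenvector
`u`, where `μ(v)` is the eigenvalue of `E(v)` at `u`: dividing by `μ` removes the cocycle. -/
noncomputable def eigenRep (C : AddSubgroup (J n → F)) (μ : C → ℂ) {u : (Fin n → F) → ℂ}
    (hu : u ≠ 0) (h : ∀ v : C, errorOp p v *ᵥ u = μ v • u) :
    Representation ℂ (Multiplicative C) ((Fin n → F) → ℂ) where
  toFun v := (μ v.toAdd)⁻¹ • Matrix.toLin' (errorOp p v.toAdd)
  map_one' := by
    rw [toAdd_one, eigenvalue_zero hu (h 0), AddSubgroup.coe_zero, errorOp_zero, inv_one, one_smul,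
      Matrix.toLin'_one, Module.End.one_eq_id]
  map_mul' v w := by
    have hμ := eigenvalue_mul hu (h v.toAdd) (h w.toAdd) (h (v.toAdd + w.toAdd))
    have hφ := cocycle_ne_zero p (v.toAdd : J n → F) w.toAdd
    refine LinearMap.ext fun x => ?_
    simp only [toAdd_mul, LinearMap.smul_apply, Module.End.mul_apply, Matrix.toLin'_apply,
      Matrix.mulVec_smul, errorOp_mulVec_mulVec, smul_smul, AddSubgroup.coe_add]
    rw [← mul_assoc, ← mul_inv, hμ, mul_inv_rev, inv_mul_cancel_right₀ hφ]

lemma eigenRep_apply (C : AddSubgroup (J n → F)) (μ : C → ℂ) {u : (Fin n → F) → ℂ} (hu : u ≠ 0)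
    (h : ∀ v : C, errorOp p v *ᵥ u = μ v • u) (v : Multiplicative C) :
    eigenRep C μ hu h v = (μ v.toAdd)⁻¹ • Matrix.toLin' (errorOp p v.toAdd) :=
  rfl

lemma trace_eigenRep (C : AddSubgroup (J n → F)) (μ : C → ℂ) {u : (Fin n → F) → ℂ} (hu : u ≠ 0)
    (h : ∀ v : C, errorOp p v *ᵥ u = μ v • u) (v : Multiplicative C) (hv : v ≠ 1) :
    LinearMap.trace ℂ _ (eigenRep C μ hu h v) = 0 := by
  have hv_ne : (v.toAdd : J n → F) ≠ 0 := fun h0 => hv (toAdd_eq_zero.mp (Subtype.ext h0))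
  rw [eigenRep_apply, map_smul, Matrix.trace_toLin'_eq, trace_errorOp p hv_ne, smul_zero]

lemma mem_invariants_eigenRep (C : AddSubgroup (J n → F)) (μ : C → ℂ) {u : (Fin n → F) → ℂ}
    (hu : u ≠ 0) (h : ∀ v : C, errorOp p v *ᵥ u = μ v • u) {x : (Fin n → F) → ℂ} :
    x ∈ (eigenRep C μ hu h).invariants ↔ ∀ v : C, errorOp p v *ᵥ x = μ v • x := by
  rw [Representation.mem_invariants, Multiplicative.forall]
  exact forall_congr' fun v => inv_smul_eq_iff₀ (eigenvalue_ne_zero hu (h v))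

lemma finrank_mul_card_of_mem_iff {Q : Submodule ℂ ((Fin n → F) → ℂ)} (hQ : Q ≠ ⊥)
    (C : AddSubgroup (J n → F)) (μ : C → ℂ)
    (h : ∀ u, u ∈ Q ↔ ∀ v : C, errorOp p v *ᵥ u = μ v • u) :
    Module.finrank ℂ Q * Nat.card C = Fintype.card F ^ n := by
  obtain ⟨u, hu, hne⟩ := Submodule.exists_mem_ne_zero_of_ne_bot hQ
  have heigen := (h u).mp hu
  have hinv : (eigenRep C μ hne heigen).invariants = Q := by
    ext x
    rw [mem_invariants_eigenRep, h]
  have hdim := finrank_invariants_mul_card _ (trace_eigenRep C μ hne heigen)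
  rwa [hinv, Nat.card_congr Multiplicative.toAdd, Module.finrank_fintype_fun_eq_card,
    Fintype.card_pi_const] at hdim

end ErrorOp

/-! ### Stabilizer codes -/

section Stabilizer

lemma sympForm_smul_left {F : Type*} [Field F] {n : ℕ} (b : F) (u v : J n → F) :
    sympForm (b • u) v = b * sympForm u v := by
  simp only [sympForm, Pi.smul_apply, smul_eq_mul, mul_sub, Finset.mul_sum, mul_assoc,
    mul_left_comm b]

lemma isIsotropic_of_trace_sympForm_eq_zero {K F : Type*} [Field K] [Field F] [Algebra K F]
    [FiniteDimensional K F] [Algebra.IsSeparable K F] {n : ℕ} {U : Submodule F (J n → F)}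
    (h : ∀ u ∈ U, ∀ v ∈ U, Algebra.trace K F (sympForm u v) = 0) : IsIsotropic U := by
  intro u hu v hv
  by_contra hne
  obtain ⟨b, hb⟩ := exists_trace_mul_ne_zero (K := K) hne
  exact hb (sympForm_smul_left b u v ▸ h (b • u) (U.smul_mem b hu) v hv)

variable (p : ℕ) [Fact p.Prime] {F : Type*} [Field F] [Fintype F] [DecidableEq F]
  [Algebra (ZMod p) F] {n : ℕ}

/-- The additive group of all `v` for which `E(v)` acts on `Q` as a scalar. -/
noncomputable def scalarGroup (Q : Submodule ℂ ((Fin n → F) → ℂ)) : AddSubgroup (J n → F) where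
  carrier := {v | ∃ c : ℂ, ∀ u ∈ Q, errorOp p v *ᵥ u = c • u}
  zero_mem' := ⟨1, fun u _ => by rw [errorOp_zero, Matrix.one_mulVec, one_smul]⟩
  add_mem' := by
    rintro v w ⟨c, hc⟩ ⟨d, hd⟩
    refine ⟨(cocycle p v w)⁻¹ * (d * c), fun u hu => ?_⟩
    rw [mul_smul, mul_smul, eq_inv_smul_iff₀ (cocycle_ne_zero p v w), ← errorOp_mulVec_mulVec,
      hd u hu, Matrix.mulVec_smul, hc u hu]
  neg_mem' := by
    rintro v ⟨c, hc⟩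
    refine ⟨c⁻¹ * cocycle p (-v) v, fun u hu => ?_⟩
    rcases eq_or_ne u 0 with rfl | hne
    · rw [Matrix.mulVec_zero, smul_zero]
    · rw [mul_smul, eq_inv_smul_iff₀ (eigenvalue_ne_zero hne (hc u hu)),
        ← errorOp_neg_mulVec_mulVec, hc u hu, Matrix.mulVec_smul]

/-- The operator `s` equals `E(v)` up to a power of `ω`, i.e. it is an element of the Pauli group
with image `v` in `F²ⁿ`. -/
def IsPauliOver (s : (Matrix (Fin n → F) (Fin n → F) ℂ)ˣ) (v : J n → F) : Prop :=
  ∃ c : ZMod p, s.val = omegaPow p c • errorOp p v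

lemma isPauliOver_one : IsPauliOver p (1 : (Matrix (Fin n → F) (Fin n → F) ℂ)ˣ) 0 :=
  ⟨0, by rw [omegaPow_zero, errorOp_zero, one_smul, Units.val_one]⟩

namespace IsPauliOver

variable {p} {s t : (Matrix (Fin n → F) (Fin n → F) ℂ)ˣ} {v w : J n → F}

lemma mul (hs : IsPauliOver p s v) (ht : IsPauliOver p t w) : IsPauliOver p (s * t) (v + w) := by
  obtain ⟨c, hc⟩ := hs
  obtain ⟨d, hd⟩ := ht
  refine ⟨c + d + Algebra.trace (ZMod p) F (∑ i, v (Sum.inr i) * w (Sum.inl i)), ?_⟩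
  rw [Units.val_mul, hc, hd, smul_mul_smul_comm, errorOp_mul, smul_smul, omegaPow_add,
    omegaPow_add]

lemma eq (hv : IsPauliOver p s v) (hw : IsPauliOver p s w) : v = w := by
  obtain ⟨c, hc⟩ := hv
  obtain ⟨d, hd⟩ := hw
  exact eq_of_smul_errorOp_eq (omegaPow_ne_zero p c) (hc.symm.trans hd)

lemma inv (hs : IsPauliOver p s v) : IsPauliOver p s⁻¹ (-v) := by
  obtain ⟨d, w, hw⟩ := (pauliGroup p F n).inv_mem ⟨hs.choose, v, hs.choose_spec⟩
  have hprod := mul hs ⟨d, hw⟩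
  rw [mul_inv_cancel] at hprod
  rw [neg_eq_of_add_eq_zero_right (hprod.eq (isPauliOver_one p))]
  exact ⟨d, hw⟩

lemma exists_mulVec_eq_smul_iff (hs : IsPauliOver p s v) : ∃ a : ℂ, ∀ (u : (Fin n → F) → ℂ) (c : ℂ),
    s.val *ᵥ u = c • u ↔ errorOp p v *ᵥ u = (a * c) • u := by
  obtain ⟨d, hd⟩ := hs
  refine ⟨(omegaPow p d)⁻¹, fun u c => ?_⟩
  rw [hd, Matrix.smul_mulVec, mul_smul, eq_inv_smul_iff₀ (omegaPow_ne_zero p d)]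

end IsPauliOver

/-- The preimage of `C` in the Pauli group. -/
def pauliSubgroup (C : AddSubgroup (J n → F)) :
    Subgroup (Matrix (Fin n → F) (Fin n → F) ℂ)ˣ where
  carrier := {s | ∃ v ∈ C, IsPauliOver p s v}
  one_mem' := ⟨0, C.zero_mem, isPauliOver_one p⟩
  mul_mem' := by
    rintro s t ⟨v, hv, hs⟩ ⟨w, hw, ht⟩
    exact ⟨v + w, C.add_mem hv hw, hs.mul ht⟩
  inv_mem' := by
    rintro s ⟨v, hv, hs⟩
    exact ⟨-v, C.neg_mem hv, hs.inv⟩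

/-- The image of `S` in `F²ⁿ` as an additive group. -/
def stabImageAddSubgroup (S : Subgroup (Matrix (Fin n → F) (Fin n → F) ℂ)ˣ) :
    AddSubgroup (J n → F) where
  carrier := stabImage p S
  zero_mem' := ⟨1, S.one_mem, isPauliOver_one p⟩
  add_mem' := by
    rintro v w ⟨s, hs, hv⟩ ⟨t, ht, hw⟩
    exact ⟨s * t, S.mul_mem hs ht, IsPauliOver.mul hv hw⟩
  neg_mem' := by
    rintro v ⟨s, hs, hv⟩
    exact ⟨s⁻¹, S.inv_mem hs, IsPauliOver.inv hv⟩

variable {p}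
variable {Q : Submodule ℂ ((Fin n → F) → ℂ)} {S : Subgroup (Matrix (Fin n → F) (Fin n → F) ℂ)ˣ}

lemma stabImageAddSubgroup_le_iff (hS : S ≤ pauliGroup p F n) {C : AddSubgroup (J n → F)} :
    stabImageAddSubgroup p S ≤ C ↔ S ≤ pauliSubgroup p C := by
  constructor
  · intro h s hs
    obtain ⟨c, v, hv⟩ := hS hs
    exact ⟨v, h ⟨s, hs, c, hv⟩, c, hv⟩
  · rintro h v ⟨s, hs, hv⟩
    obtain ⟨w, hw, hsw⟩ := h hs
    rwa [IsPauliOver.eq hv hsw]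

namespace IsStabilizer

lemma stabImageAddSubgroup_le (hS : IsStabilizer p S Q) :
    stabImageAddSubgroup p S ≤ scalarGroup p Q := by
  rintro v ⟨s, hs, hv⟩
  obtain ⟨-, -, ev, hev⟩ := hS
  obtain ⟨a, ha⟩ := IsPauliOver.exists_mulVec_eq_smul_iff hv
  exact ⟨_, fun u hu => (ha u _).mp ((hev u).mp hu s hs)⟩

lemma mem_of_forall_mulVec_eq_smul (hS : IsStabilizer p S Q) {u₀ u : (Fin n → F) → ℂ}
    (hu₀ : u₀ ∈ Q) (hne : u₀ ≠ 0)
    (h : ∀ v ∈ stabImage p S, ∃ c : ℂ, errorOp p v *ᵥ u₀ = c • u₀ ∧ errorOp p v *ᵥ u = c • u) :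
    u ∈ Q := by
  obtain ⟨hP, -, ev, hev⟩ := hS
  refine (hev u).mpr fun s hs => ?_
  obtain ⟨d, v, hv⟩ := hP hs
  obtain ⟨c, hc₀, hc⟩ := h v ⟨s, hs, d, hv⟩
  obtain ⟨a, ha⟩ := IsPauliOver.exists_mulVec_eq_smul_iff ⟨d, hv⟩
  have hac := (ha u₀ _).mp ((hev u₀).mp hu₀ s hs)
  rw [ha, hc, smul_left_injective ℂ hne (hc₀.symm.trans hac)]

lemma finrank_mul_card (hS : IsStabilizer p S Q) (hQ : Q ≠ ⊥) {C : AddSubgroup (J n → F)}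
    (hSC : stabImageAddSubgroup p S ≤ C) (hCQ : C ≤ scalarGroup p Q) :
    Module.finrank ℂ Q * Nat.card C = Fintype.card F ^ n := by
  choose μ hμ using fun v : C => hCQ v.2
  refine finrank_mul_card_of_mem_iff hQ C μ fun u => ⟨fun hu v => hμ v u hu, fun h => ?_⟩
  obtain ⟨u₀, hu₀, hne⟩ := Submodule.exists_mem_ne_zero_of_ne_bot hQ
  exact hS.mem_of_forall_mulVec_eq_smul hu₀ hne fun v hv =>
    ⟨μ ⟨v, hSC hv⟩, hμ ⟨v, hSC hv⟩ u₀ hu₀, h ⟨v, hSC hv⟩⟩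

theorem stabImageAddSubgroup_eq (hS : IsStabilizer p S Q) (hQ : Q ≠ ⊥) :
    stabImageAddSubgroup p S = scalarGroup p Q := by
  have hle := hS.stabImageAddSubgroup_le
  have hcard := (hS.finrank_mul_card hQ hle le_rfl).trans (hS.finrank_mul_card hQ le_rfl hle).symm
  have hpos : 0 < Module.finrank ℂ Q :=
    Module.finrank_pos_iff.mpr (Submodule.nontrivial_iff_ne_bot.mpr hQ)
  exact AddSubgroup.eq_of_le_of_card_ge hle (Nat.eq_of_mul_eq_mul_left hpos hcard).le

end IsStabilizer

lemma cocycle_comm_of_mem_scalarGroup (hQ : Q ≠ ⊥) {v w : J n → F} (hv : v ∈ scalarGroup p Q)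
    (hw : w ∈ scalarGroup p Q) : cocycle p v w = cocycle p w v := by
  obtain ⟨u, hu, hne⟩ := Submodule.exists_mem_ne_zero_of_ne_bot hQ
  have ⟨c, hc⟩ := hv
  have ⟨d, hd⟩ := hw
  obtain ⟨e, he⟩ := add_mem hv hw
  have hvw := eigenvalue_mul hne (hc u hu) (hd u hu) (he u hu)
  have hwv := eigenvalue_mul hne (hd u hu) (hc u hu) (add_comm v w ▸ he u hu)
  exact mul_right_cancel₀ (eigenvalue_ne_zero hne (he u hu)) (by rw [← hvw, ← hwv, mul_comm])

lemma isIsotropic_of_le_scalarGroup (hQ : Q ≠ ⊥) {U : Submodule F (J n → F)}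
    (hU : U.toAddSubgroup ≤ scalarGroup p Q) : IsIsotropic U :=
  isIsotropic_of_trace_sympForm_eq_zero (K := ZMod p) fun _ hu _ hv =>
    (cocycle_comm_iff p).mp (cocycle_comm_of_mem_scalarGroup hQ (hU hu) (hU hv))

lemma IsCSSCode.coordProj_mem_scalarGroup (hcss : IsCSSCode p Q) (hQ : Q ≠ ⊥) {v : J n → F}
    (hv : v ∈ scalarGroup p Q) : coordProj {x | x.isLeft} v ∈ scalarGroup p Q := by
  obtain ⟨S, hS, hgen⟩ := hcss
  have himage := hS.stabImageAddSubgroup_eq hQ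
  let C := (scalarGroup p Q).comap (coordProj (F := F) {x : J n | x.isLeft}).toAddMonoidHom
  suffices h : stabImageAddSubgroup p S ≤ C from h (himage.ge hv)
  rw [stabImageAddSubgroup_le_iff hS.1, hgen, Subgroup.closure_le]
  rintro s ⟨hs, c, w, hc, hw⟩
  refine ⟨w, ?_, c, hc⟩
  change coordProj _ w ∈ scalarGroup p Q
  rcases hw with hw | hw
  · rw [coordProj_eq_self (by simpa using hw)]
    exact himage.le ⟨s, hs, c, hc⟩
  · rw [coordProj_eq_zero (by simpa using hw)]
    exact zero_mem _

end Stabilizer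

end QuantumSymplectic

open QuantumSymplectic in
theorem mainTheorem1_general (p : ℕ) [Fact p.Prime] (F : Type*) [Field F] [Fintype F]
    [DecidableEq F] [Algebra (ZMod p) F] (n : ℕ) (Q : Submodule ℂ ((Fin n → F) → ℂ))
    (hQ : Q ≠ ⊥) (hlin : IsLinearStabilizerCode p Q) :
    ∃ 𝓜 : SymplecticMatroid n,
      𝓜.IsRepresentable F ∧
      Module.finrank ℂ Q * Fintype.card F ^ 𝓜.rank = Fintype.card F ^ n ∧
      (∀ S, IsStabilizer p S Q →
        (∃ M : Matrix (Fin 𝓜.rank) (J n) F, IsStabilizerMatrix p S M) ∧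
        ∀ (r : ℕ) (M : Matrix (Fin r) (J n) F), IsStabilizerMatrix p S M → Represents M 𝓜) ∧
      (IsCSSCode p Q → 𝓜.IsHomogeneous) := by
  obtain ⟨S₀, hS₀, U, hU⟩ := hlin
  have himage (S) (hS : IsStabilizer p S Q) : stabImage p S = scalarGroup p Q :=
    congrArg SetLike.coe (hS.stabImageAddSubgroup_eq hQ)
  have hUQ : U.toAddSubgroup = scalarGroup p Q :=
    SetLike.coe_injective (hU.trans (himage S₀ hS₀))
  have hiso : IsIsotropic U := isIsotropic_of_le_scalarGroup hQ hUQ.le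
  have hspan (S) (hS : IsStabilizer p S Q) : (U : Set (J n → F)) = stabImage p S :=
    hU.trans ((himage S₀ hS₀).trans (himage S hS).symm)
  have hdim : Module.finrank ℂ Q * Fintype.card F ^ Module.finrank F U = Fintype.card F ^ n := by
    rw [← Nat.card_eq_fintype_card (α := F), ← Module.natCard_eq_pow_finrank,
      Nat.card_eq_fintype_card (α := F)]
    exact hS₀.finrank_mul_card hQ (hUQ ▸ hS₀.stabImageAddSubgroup_le) hUQ.le
  obtain ⟨M, hM, hMU⟩ := exists_matrix_span_range_row_eq U
  refine ⟨.ofIsotropic U hiso, ⟨_, M, represents_ofIsotropic hM hiso hMU⟩, hdim, fun S hS =>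
    ⟨⟨M, hM, (congrArg SetLike.coe hMU).trans (hspan S hS)⟩, fun r N hN => ?_⟩, fun hcss => ?_⟩
  · exact represents_ofIsotropic hN.1 hiso (SetLike.coe_injective (hN.2.trans (hspan S hS).symm))
  · exact isHomogeneous_ofIsotropic hiso fun u hu =>
      hUQ.ge (hcss.coordProj_mem_scalarGroup hQ (hUQ.le hu))

theorem mainTheorem1 (p : ℕ) [Fact p.Prime] (F : Type*) [Field F] [Fintype F] [DecidableEq F]
    [Algebra (ZMod p) F] (n k d : ℕ) (Q : Submodule ℂ ((Fin n → F) → ℂ))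
    (hQ : QuantumSymplectic.IsQuantumCode p k d Q)
    (hlin : QuantumSymplectic.IsLinearStabilizerCode p Q) :
    ∃ 𝓜 : QuantumSymplectic.SymplecticMatroid n,
      𝓜.IsRepresentable F ∧ 𝓜.rank = n - k ∧
      (∀ S, QuantumSymplectic.IsStabilizer p S Q →
        (∃ M : Matrix (Fin (n - k)) (QuantumSymplectic.J n) F,
          QuantumSymplectic.IsStabilizerMatrix p S M) ∧
        ∀ (r : ℕ) (M : Matrix (Fin r) (QuantumSymplectic.J n) F),
          QuantumSymplectic.IsStabilizerMatrix p S M → QuantumSymplectic.Represents M 𝓜) ∧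
      (QuantumSymplectic.IsCSSCode p Q → 𝓜.IsHomogeneous) := by
  have hcard := Fintype.one_lt_card (α := F)
  have hne : Q ≠ ⊥ := by
    rintro rfl
    exact (pow_pos (zero_lt_one.trans hcard) k).ne ((finrank_bot ℂ _).symm.trans hQ.1)
  obtain ⟨𝓜, hrep, hdim, hstab, hcss⟩ := mainTheorem1_general p F n Q hne hlin
  have hrank : 𝓜.rank = n - k := by
    rw [hQ.1, ← pow_add] at hdim
    exact Nat.eq_sub_of_add_eq' (Nat.pow_right_injective hcard hdim)
  exact ⟨𝓜, hrep, hrank, hrank ▸ hstab, hcss⟩
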